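/- For positive integers $a_1,\ldots,a_m$ with $a_1\geqslant 2$, let $$\zeta(a_1,\ldots,a_m)=\sum_{n_1>\cdots>n_m>0} n_1^{-a_1}\cdots n_m^{-a_m}$$ be the multiple zeta value, where $n_1,\ldots,n_m$ run over the integers; for $m=1$ it is the value $\zeta(a_1)$ of the Riemann zeta function. **Theorem (Zagier's formula).** For all integers $a\geqslant 0$ and $b\geqslant 0$, with $k=2a+2b+3$, the series defining $\zeta(\underbrace{2,\ldots,2}_{a},3,\underbrace{2,\ldots,2}_{b})$ converges (absolutely) and $$\begin{aligned} \zeta(\underbrace{2,\ldots,2}_{a},3,\underbrace{2,\ldots,2}_{b}) ={}&2\sum_{r=b+1}^{a+b+1}(-1)^r\binom{2r}{2b+2}\frac{\pi^{k-1-2r}}{(k-2r)!}\,\zeta(2r+1)\\ &-2\sum_{r=a+1}^{a+b+1}(-1)^r\binom{2r}{2a+1}\frac{\pi^{k-1-2r}}{(k-2r)!}\,\bigl(1-2^{-2r}\bigr)\,\zeta(2r+1). \end{aligned}$$ -/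

import Mathlib

/-- The index set of the series of a multiple zeta value of depth `r`:
sequences `n₁ > ⋯ > n_r > 0` of integers. -/
def MZVIndex (r : ℕ) : Type :=
  {n : Fin r → ℕ // StrictAnti n ∧ ∀ i, 0 < n i}

/-- The term `n₁ ^ (-a₁) ⋯ n_r ^ (-a_r)` of the series attached to the composition
`a = (a₁, …, a_r)`. -/
noncomputable def mzvTerm (a : List ℕ) (n : MZVIndex a.length) : ℝ :=
  ∏ i : Fin a.length, ((n.1 i : ℝ) ^ a.get i)⁻¹

/-- The multiple zeta value `ζ(a₁, …, a_r) = ∑_{n₁ > ⋯ > n_r > 0} n₁ ^ (-a₁) ⋯ n_r ^ (-a_r)`. -/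
noncomputable def multiZeta (a : List ℕ) : ℝ :=
  ∑' n : MZVIndex a.length, mzvTerm a n

/-- The composition `(2, …, 2, 3, 2, …, 2)` with `a` twos before the `3` and `b` twos after it. -/
def twosThreeTwos (a b : ℕ) : List ℕ :=
  List.replicate a 2 ++ 3 :: List.replicate b 2

/-! Sorting the multiple sum by the value `n` of the variable attached to the exponent 3 gives `∑
n⁻³ U_a(n) L_b(n)`, where `U_a(n)` collects the variables above `n` and `L_b(n)` those below. Both
factors are governed by powers of `sin`.

The ratio of `∫₀^{π/2} (π - 2t)^(2a)/(2a)! sin^(2n) t dt` to its value at `a = 0` obeys the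
difference equation of `U_a` and tends to 0 for `a ≥ 1`, hence equals `U_a(n)` (`twosUpperSum_sub`,
`hasSum_twosUpperSum`). With `w_n = binom(2n, n)/4^n`, the numbers `L_b(n)/(n² w_n)` are the
coefficients of `(2t)^(2b+2)/(2b+2)!` as a series in `sin² t` (`hasSum_arcsinTerm`). One integration
by parts cancels `w_n`, and summing under the integral turns the value into a multiple of `∫₀^{π/2}
(π - 2t)^(2a+1) (2t)^(2b+2) cot t dt` (`hasSum_inv_cube_mul_twosSums`).

Finally `cot t = 2 ∑ sin 2nt` in the weak sense (`tendsto_sum_integral_sin`). Integrating the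
polynomial against each sine leaves its even derivatives at 0 and `π`. The first give the sums `∑
n^(-2j-1)`, the second their alternating versions, which are the two families of zeta values in the
formula. -/

/-! ### Central binomial ratios. -/

/-- The normalised central binomial coefficient `binom (2n) n / 4 ^ n`. -/
noncomputable def wallisRatio (n : ℕ) : ℝ := (Nat.centralBinom n : ℝ) / 4 ^ n

lemma wallisRatio_pos (n : ℕ) : 0 < wallisRatio n := by
  have := Nat.centralBinom_pos n
  unfold wallisRatio
  positivity

lemma wallisRatio_zero : wallisRatio 0 = 1 := by simp [wallisRatio]

lemma wallisRatio_succ (n : ℕ) :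
    (2 * (n : ℝ) + 2) * wallisRatio (n + 1) = (2 * n + 1) * wallisRatio n := by
  have h : ((n : ℝ) + 1) * (Nat.centralBinom (n + 1) : ℝ) =
      2 * (2 * n + 1) * Nat.centralBinom n := by
    exact_mod_cast Nat.succ_mul_centralBinom_succ n
  have h4 : (4 : ℝ) ^ n ≠ 0 := by positivity
  unfold wallisRatio
  rw [pow_succ]
  field_simp
  linarith

/-- Polynomial growth is all that is needed: it is later beaten by the geometric decay of `sin^(2n)
t` for `t < π/2`. -/
lemma inv_wallisRatio_le (n : ℕ) : (wallisRatio n)⁻¹ ≤ 2 * n + 1 := by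
  rcases Nat.eq_zero_or_pos n with rfl | hn
  · simp [wallisRatio]
  have h : (4 : ℝ) ^ n ≤ 2 * n * Nat.centralBinom n := by
    exact_mod_cast Nat.four_pow_le_two_mul_self_mul_centralBinom n hn
  have hc : (0 : ℝ) < Nat.centralBinom n := by exact_mod_cast Nat.centralBinom_pos n
  rw [wallisRatio, inv_div, div_le_iff₀ hc]
  linarith

/-! ### Moments of even powers of the sine, and the sums over variables above `n`. -/

/-- The moment `∫₀^{π/2} (π - 2t)^(2a) / (2a)! * sin^(2n) t dt`. -/
noncomputable def sinMoment (a n : ℕ) : ℝ :=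
  ∫ t in (0 : ℝ)..(Real.pi / 2),
    (Real.pi - 2 * t) ^ (2 * a) / (2 * a).factorial * Real.sin t ^ (2 * n)

lemma sinMoment_intervalIntegrable (a n : ℕ) (x y : ℝ) :
    IntervalIntegrable (fun t : ℝ =>
      (Real.pi - 2 * t) ^ (2 * a) / (2 * a).factorial * Real.sin t ^ (2 * n))
      MeasureTheory.volume x y :=
  Continuous.intervalIntegrable (by fun_prop) _ _

lemma hasDerivAt_pi_sub_pow_div_factorial (m : ℕ) (t : ℝ) :
    HasDerivAt (fun t : ℝ => (Real.pi - 2 * t) ^ (m + 1) / (m + 1).factorial)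
      (-2 * ((Real.pi - 2 * t) ^ m / m.factorial)) t := by
  have h : HasDerivAt (fun t : ℝ => Real.pi - 2 * t) (-2) t := by
    simpa using ((hasDerivAt_id t).const_mul 2).const_sub Real.pi
  refine HasDerivAt.congr_deriv ((h.fun_pow (m + 1)).div_const ((m + 1).factorial : ℝ)) ?_
  have := Nat.factorial_pos m
  rw [Nat.factorial_succ]
  push_cast
  field_simp

lemma hasDerivAt_sin_pow (m : ℕ) (t : ℝ) :
    HasDerivAt (fun t : ℝ => Real.sin t ^ (m + 1)) ((m + 1) * Real.sin t ^ m * Real.cos t) t := by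
  refine ((Real.hasDerivAt_sin t).fun_pow (m + 1)).congr_deriv ?_
  simp

lemma hasDerivAt_sin_pow_mul_cos (m : ℕ) (t : ℝ) :
    HasDerivAt (fun t : ℝ => Real.sin t ^ (m + 1) * Real.cos t)
      ((m + 1) * Real.sin t ^ m - (m + 2) * Real.sin t ^ (m + 2)) t := by
  refine ((hasDerivAt_sin_pow m t).mul (Real.hasDerivAt_cos t)).congr_deriv ?_
  have h := Real.sin_sq_add_cos_sq t
  have h2 : Real.cos t * Real.cos t = 1 - Real.sin t ^ 2 := by linarith
  linear_combination (m + 1) * Real.sin t ^ m * h2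

lemma sinMoment_zero_succ (n : ℕ) :
    (2 * (n : ℝ) + 2) * sinMoment 0 (n + 1) = (2 * n + 1) * sinMoment 0 n := by
  have h := intervalIntegral.integral_eq_sub_of_hasDerivAt
    (fun t _ => hasDerivAt_sin_pow_mul_cos (2 * n) t)
    (Continuous.intervalIntegrable (by fun_prop) 0 (Real.pi / 2))
  rw [intervalIntegral.integral_sub (Continuous.intervalIntegrable (by fun_prop) _ _)
    (Continuous.intervalIntegrable (by fun_prop) _ _), intervalIntegral.integral_const_mul,
    intervalIntegral.integral_const_mul] at h
  simp only [Real.cos_pi_div_two, Real.sin_zero] at h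
  simp [sinMoment, mul_add] at h ⊢
  linarith

lemma sinMoment_zero (n : ℕ) : sinMoment 0 n = Real.pi / 2 * wallisRatio n := by
  induction n with
  | zero => simp [sinMoment, wallisRatio]
  | succ n ih =>
    have h1 := sinMoment_zero_succ n
    have h2 := wallisRatio_succ n
    have h3 : (2 * (n : ℝ) + 2) ≠ 0 := by positivity
    apply mul_left_cancel₀ h3
    rw [h1, ih]
    linear_combination -(Real.pi / 2) * h2

/-- Two integrations by parts done at once. The boundary terms vanish because `sin 0 = 0` and
because `π - 2t` is zero at `π/2`. -/
lemma sinMoment_succ_succ (a n : ℕ) :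
    (2 * (n : ℝ) + 2) * (2 * n + 1) * sinMoment (a + 1) n
      - (2 * n + 2) ^ 2 * sinMoment (a + 1) (n + 1) = 4 * sinMoment a (n + 1) := by
  -- The weights `2n + 2` and `2` make the terms containing `(π - 2t)^(2a+1)` cancel in the
  -- derivative.
  have hd : ∀ t ∈ Set.uIcc 0 (Real.pi / 2), HasDerivAt (fun t : ℝ =>
      (2 * (n : ℝ) + 2) * ((Real.pi - 2 * t) ^ (2 * (a + 1)) / (2 * (a + 1)).factorial *
        (Real.sin t ^ (2 * n + 1) * Real.cos t)) +
      2 * ((Real.pi - 2 * t) ^ (2 * a + 1) / (2 * a + 1).factorial * Real.sin t ^ (2 * n + 1 + 1)))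
      ((2 * (n : ℝ) + 2) * (2 * n + 1) *
          ((Real.pi - 2 * t) ^ (2 * (a + 1)) / (2 * (a + 1)).factorial * Real.sin t ^ (2 * n))
        - (2 * n + 2) ^ 2 * ((Real.pi - 2 * t) ^ (2 * (a + 1)) / (2 * (a + 1)).factorial *
          Real.sin t ^ (2 * (n + 1)))
        - 4 * ((Real.pi - 2 * t) ^ (2 * a) / (2 * a).factorial * Real.sin t ^ (2 * (n + 1)))) t := by
    intro t _
    refine HasDerivAt.congr_deriv ((((hasDerivAt_pi_sub_pow_div_factorial (2 * a + 1) t).mul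
      (hasDerivAt_sin_pow_mul_cos (2 * n) t)).const_mul (2 * (n : ℝ) + 2)).add
      (((hasDerivAt_pi_sub_pow_div_factorial (2 * a) t).mul
      (hasDerivAt_sin_pow (2 * n + 1) t)).const_mul 2)) ?_
    push_cast
    rw [show 2 * (n + 1) = 2 * n + 2 by ring, show 2 * (a + 1) = 2 * a + 1 + 1 by ring]
    ring
  have h := intervalIntegral.integral_eq_sub_of_hasDerivAt hd
    (Continuous.intervalIntegrable (by fun_prop) 0 (Real.pi / 2))
  rw [intervalIntegral.integral_sub (Continuous.intervalIntegrable (by fun_prop) _ _)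
    (Continuous.intervalIntegrable (by fun_prop) _ _),
    intervalIntegral.integral_sub (Continuous.intervalIntegrable (by fun_prop) _ _)
    (Continuous.intervalIntegrable (by fun_prop) _ _), intervalIntegral.integral_const_mul,
    intervalIntegral.integral_const_mul, intervalIntegral.integral_const_mul] at h
  have h0 : Real.pi - 2 * (Real.pi / 2) = 0 := by ring
  simp only [Real.cos_pi_div_two, Real.sin_zero, h0] at h
  simp at h
  unfold sinMoment
  linarith

/-- The normalised moment `sinMoment a n / sinMoment 0 n`, which equals
`∑_{n₁ > ⋯ > n_a > n} (n₁ ⋯ n_a)⁻²`. -/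
noncomputable def twosUpperSum (a n : ℕ) : ℝ := sinMoment a n / sinMoment 0 n

lemma sinMoment_zero_pos (n : ℕ) : 0 < sinMoment 0 n := by
  rw [sinMoment_zero]
  have := wallisRatio_pos n
  positivity

lemma twosUpperSum_zero (n : ℕ) : twosUpperSum 0 n = 1 :=
  div_self (sinMoment_zero_pos n).ne'

lemma twosUpperSum_nonneg (a n : ℕ) : 0 ≤ twosUpperSum a n := by
  refine div_nonneg ?_ (sinMoment_zero_pos n).le
  refine intervalIntegral.integral_nonneg (by positivity) fun t ht => ?_
  have := Even.pow_nonneg (even_two_mul a) (Real.pi - 2 * t)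
  have := Even.pow_nonneg (even_two_mul n) (Real.sin t)
  positivity

lemma twosUpperSum_sub (a n : ℕ) :
    twosUpperSum (a + 1) n - twosUpperSum (a + 1) (n + 1) =
      (((n + 1 : ℕ) : ℝ) ^ 2)⁻¹ * twosUpperSum a (n + 1) := by
  have h1 := sinMoment_zero_succ n
  have h2 := sinMoment_succ_succ a n
  have p1 := sinMoment_zero_pos n
  have p2 := sinMoment_zero_pos (n + 1)
  have hn : sinMoment 0 n = (2 * n + 2) / (2 * n + 1) * sinMoment 0 (n + 1) := by
    field_simp
    linarith
  unfold twosUpperSum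
  rw [hn]
  push_cast
  field_simp
  linear_combination h2 / 2

/-- Jordan's inequality gives `π - 2t ≤ π cos t`. Keeping only `cos² t = 1 - sin² t` bounds the
moment by a difference of consecutive Wallis integrals, which supplies the factor `1/(2n + 2)`. -/
lemma twosUpperSum_succ_le (a n : ℕ) :
    twosUpperSum (a + 1) n ≤ Real.pi ^ (2 * (a + 1)) / (2 * n + 2) := by
  have key : sinMoment (a + 1) n ≤ Real.pi ^ (2 * (a + 1)) * (sinMoment 0 n - sinMoment 0 (n + 1)) := by
    unfold sinMoment
    rw [← intervalIntegral.integral_sub (sinMoment_intervalIntegrable _ _ _ _)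
      (sinMoment_intervalIntegrable _ _ _ _), ← intervalIntegral.integral_const_mul]
    refine intervalIntegral.integral_mono_on (by positivity) (sinMoment_intervalIntegrable _ _ _ _)
      (Continuous.intervalIntegrable (by fun_prop) _ _) fun t ht => ?_
    have hs := Even.pow_nonneg (even_two_mul n) (Real.sin t)
    have h0 : 0 ≤ Real.pi / 2 - t := by linarith [ht.2]
    have h1 := Real.mul_le_sin h0 (by linarith [ht.1])
    rw [Real.sin_pi_div_two_sub] at h1
    have hc0 : 0 ≤ Real.cos t := le_trans (by positivity) h1
    have h2 : Real.pi - 2 * t ≤ Real.pi * Real.cos t := by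
      have := mul_le_mul_of_nonneg_left h1 Real.pi_pos.le
      field_simp at this
      linarith
    have h3 : (Real.pi - 2 * t) ^ (2 * (a + 1)) ≤ Real.pi ^ (2 * (a + 1)) * Real.cos t ^ 2 := by
      calc _ ≤ (Real.pi * Real.cos t) ^ (2 * (a + 1)) :=
            pow_le_pow_left₀ (by linarith) h2 _
        _ = Real.pi ^ (2 * (a + 1)) * Real.cos t ^ (2 * (a + 1)) := mul_pow _ _ _
        _ ≤ _ := mul_le_mul_of_nonneg_left
          (pow_le_pow_of_le_one hc0 (Real.cos_le_one t) (by omega)) (by positivity)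
    have h4 : (Real.pi - 2 * t) ^ (2 * (a + 1)) / (2 * (a + 1)).factorial ≤
        Real.pi ^ (2 * (a + 1)) * Real.cos t ^ 2 := by
      refine le_trans (div_le_self (Even.pow_nonneg (even_two_mul _) _) ?_) h3
      exact_mod_cast Nat.factorial_pos _
    calc _ ≤ Real.pi ^ (2 * (a + 1)) * Real.cos t ^ 2 * Real.sin t ^ (2 * n) := by gcongr
      _ = _ := by
        rw [Real.cos_sq']
        simp
        ring
  have h1 := sinMoment_zero_succ n
  have p1 := sinMoment_zero_pos n
  rw [twosUpperSum, div_le_iff₀ p1]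
  refine key.trans (le_of_eq ?_)
  field_simp
  linarith

lemma tendsto_twosUpperSum_succ (a : ℕ) :
    Filter.Tendsto (twosUpperSum (a + 1)) Filter.atTop (nhds 0) := by
  refine squeeze_zero (twosUpperSum_nonneg _) (twosUpperSum_succ_le a) ?_
  refine Filter.Tendsto.div_atTop tendsto_const_nhds ?_
  refine Filter.tendsto_atTop_add_const_right _ _ ?_
  exact tendsto_natCast_atTop_atTop.const_mul_atTop two_pos

/-- The difference equation telescopes and the tail vanishes, so the normalised moments satisfy the
recursion of the nested sums. -/
lemma hasSum_twosUpperSum (a n : ℕ) :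
    HasSum (fun m : ℕ => (((n + m + 1 : ℕ) : ℝ) ^ 2)⁻¹ * twosUpperSum a (n + m + 1))
      (twosUpperSum (a + 1) n) := by
  rw [hasSum_iff_tendsto_nat_of_nonneg fun m =>
    mul_nonneg (by positivity) (twosUpperSum_nonneg _ _)]
  have h : ∀ N : ℕ, ∑ m ∈ Finset.range N,
      (((n + m + 1 : ℕ) : ℝ) ^ 2)⁻¹ * twosUpperSum a (n + m + 1) =
        twosUpperSum (a + 1) n - twosUpperSum (a + 1) (n + N) := by
    intro N
    rw [Finset.sum_congr rfl fun m _ => (twosUpperSum_sub a (n + m)).symm]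
    exact Finset.sum_range_sub' (fun m => twosUpperSum (a + 1) (n + m)) N
  simp_rw [h]
  have := (tendsto_twosUpperSum_succ a).comp (Filter.tendsto_add_atTop_nat n)
  simpa [Function.comp_def, add_comm] using this.const_sub (twosUpperSum (a + 1) n)

/-! ### Sums over variables below `n`. -/

/-- The finite sum `∑_{n > n₁ > ⋯ > n_b > 0} (n₁ ⋯ n_b)⁻²`. -/
noncomputable def twosLowerSum : ℕ → ℕ → ℝ
  | 0, _ => 1
  -- The summand `m = 0` is zero, since `0⁻¹ = 0`.
  | b + 1, n => ∑ m ∈ Finset.range n, ((m : ℝ) ^ 2)⁻¹ * twosLowerSum b m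

lemma twosLowerSum_nonneg (b n : ℕ) : 0 ≤ twosLowerSum b n := by
  induction b generalizing n with
  | zero => simp [twosLowerSum]
  | succ b ih => exact Finset.sum_nonneg fun m _ => mul_nonneg (by positivity) (ih m)

lemma twosLowerSum_succ_succ (b n : ℕ) :
    twosLowerSum (b + 1) (n + 1) =
      twosLowerSum (b + 1) n + ((n : ℝ) ^ 2)⁻¹ * twosLowerSum b n :=
  Finset.sum_range_succ _ _

lemma twosLowerSum_le (b n : ℕ) : twosLowerSum b n ≤ (n : ℝ) ^ b := by
  induction b generalizing n with
  | zero => simp [twosLowerSum]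
  | succ b ih =>
    calc twosLowerSum (b + 1) n ≤ ∑ m ∈ Finset.range n, (n : ℝ) ^ b := by
          refine Finset.sum_le_sum fun m hm => ?_
          have hmn : (m : ℝ) ≤ n := by exact_mod_cast (Finset.mem_range.1 hm).le
          have h1 : ((m : ℝ) ^ 2)⁻¹ ≤ 1 := by
            rcases Nat.eq_zero_or_pos m with rfl | h
            · simp
            · exact inv_le_one_of_one_le₀ (one_le_pow₀ (by exact_mod_cast h))
          calc _ ≤ 1 * twosLowerSum b m := by gcongr; exact twosLowerSum_nonneg _ _
            _ ≤ (m : ℝ) ^ b := by rw [one_mul]; exact ih m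
            _ ≤ _ := by gcongr
      _ = (n : ℝ) ^ (b + 1) := by simp [pow_succ, mul_comm]

/-! ### Even powers of the arcsine as power series. -/

/-- The `n`-th term of the expansion of `(2t)^(2b+2) / (2b+2)!` in even powers of `sin t`. -/
noncomputable def arcsinTerm (b n : ℕ) (t : ℝ) : ℝ :=
  twosLowerSum b n / ((n : ℝ) ^ 2 * wallisRatio n) * Real.sin t ^ (2 * n)

/-- The derivative of `arcsinTerm b n`. -/
noncomputable def arcsinTermDeriv (b n : ℕ) (t : ℝ) : ℝ :=
  twosLowerSum b n / ((n : ℝ) ^ 2 * wallisRatio n) *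
    (2 * n * (Real.sin t ^ (2 * n - 1) * Real.cos t))

lemma hasDerivAt_arcsinTerm (b n : ℕ) (t : ℝ) :
    HasDerivAt (arcsinTerm b n) (arcsinTermDeriv b n t) t := by
  unfold arcsinTerm arcsinTermDeriv
  rcases n with _ | n
  · simpa using hasDerivAt_const t (0 : ℝ)
  · refine HasDerivAt.congr_deriv ((hasDerivAt_sin_pow (2 * n + 1) t).const_mul
      (twosLowerSum b (n + 1) / (((n + 1 : ℕ) : ℝ) ^ 2 * wallisRatio (n + 1)))) ?_
    rw [show 2 * (n + 1) - 1 = 2 * n + 1 by omega]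
    push_cast
    ring

lemma hasDerivAt_arcsinTermDeriv_succ (b n : ℕ) (t : ℝ) :
    HasDerivAt (arcsinTermDeriv b (n + 1))
      (4 * (twosLowerSum b (n + 1) / wallisRatio n * Real.sin t ^ (2 * n)
        - twosLowerSum b (n + 1) / wallisRatio (n + 1) * Real.sin t ^ (2 * (n + 1)))) t := by
  unfold arcsinTermDeriv
  refine HasDerivAt.congr_deriv
    (((hasDerivAt_sin_pow_mul_cos (2 * n) t).const_mul (2 * ((n + 1 : ℕ) : ℝ))).const_mul
      (twosLowerSum b (n + 1) / (((n + 1 : ℕ) : ℝ) ^ 2 * wallisRatio (n + 1)))) ?_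
  have h := wallisRatio_succ n
  have p1 := wallisRatio_pos (n + 1)
  have hn : wallisRatio n = (2 * n + 2) / (2 * n + 1) * wallisRatio (n + 1) := by
    field_simp
    linarith
  rw [hn]
  push_cast
  rw [show 2 * (n + 1) = 2 * n + 2 by ring]
  field_simp
  ring

lemma arcsinTermDeriv_zero_index (b : ℕ) : arcsinTermDeriv b 0 = fun _ => 0 := by
  ext t; simp [arcsinTermDeriv]

lemma arcsinTerm_zero_index (b : ℕ) : arcsinTerm b 0 = fun _ => 0 := by
  ext t; simp [arcsinTerm]

/-- The error term in the second derivative of the partial sums of the expansion. -/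
noncomputable def arcsinTail (b n : ℕ) (t : ℝ) : ℝ :=
  twosLowerSum b n / wallisRatio n * Real.sin t ^ (2 * n)

lemma sum_second_deriv_zero (N : ℕ) (t : ℝ) :
    ∑ n ∈ Finset.range N, (4 * (twosLowerSum 0 (n + 1) / wallisRatio n * Real.sin t ^ (2 * n)
        - twosLowerSum 0 (n + 1) / wallisRatio (n + 1) * Real.sin t ^ (2 * (n + 1)))) =
      4 * (1 - arcsinTail 0 N t) := by
  rw [← Finset.mul_sum]
  congr 1
  have h := Finset.sum_range_sub' (fun n => arcsinTail 0 n t) N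
  have h0 : arcsinTail 0 0 t = 1 := by simp [arcsinTail, twosLowerSum, wallisRatio_zero]
  rw [h0] at h
  rw [← h]
  rfl

/-- Up to a telescoping part, the increment `n⁻² twosLowerSum b n` of the lower sum leaves exactly
the series of level `b`. This mirrors the second derivative of `(2t)^(2b+4)/(2b+4)!` being `4
(2t)^(2b+2)/(2b+2)!`. -/
lemma sum_second_deriv_succ (b N : ℕ) (t : ℝ) :
    ∑ n ∈ Finset.range N, (4 * (twosLowerSum (b + 1) (n + 1) / wallisRatio n * Real.sin t ^ (2 * n)
        - twosLowerSum (b + 1) (n + 1) / wallisRatio (n + 1) * Real.sin t ^ (2 * (n + 1)))) =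
      4 * (∑ n ∈ Finset.range N, arcsinTerm b n t - arcsinTail (b + 1) N t) := by
  rw [← Finset.mul_sum]
  congr 1
  have h := Finset.sum_range_sub' (fun n => arcsinTail (b + 1) n t) N
  have h0 : arcsinTail (b + 1) 0 t = 0 := by simp [arcsinTail, twosLowerSum]
  rw [h0] at h
  rw [sub_eq_add_neg, ← zero_sub, ← h, ← Finset.sum_add_distrib]
  refine Finset.sum_congr rfl fun n _ => ?_
  simp only [arcsinTail, arcsinTerm]
  have p := wallisRatio_pos n
  rw [twosLowerSum_succ_succ]
  rcases Nat.eq_zero_or_pos n with rfl | hn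
  · simp
  · field_simp
    ring

lemma abs_le_of_second_deriv_le {f f' f'' : ℝ → ℝ} {M t : ℝ} (h0 : f 0 = 0) (h0' : f' 0 = 0)
    (hf : ∀ s, HasDerivAt f (f' s) s) (hf' : ∀ s, HasDerivAt f' (f'' s) s)
    (hM : ∀ s ∈ Set.Icc 0 t, |f'' s| ≤ M) : ∀ s ∈ Set.Icc 0 t, |f s| ≤ M * t * t := by
  have h1 : ∀ s ∈ Set.Icc 0 t, |f' s| ≤ M * t := by
    intro s hs
    have hM0 : 0 ≤ M := le_trans (abs_nonneg _) (hM s hs)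
    have := (convex_Icc 0 t).norm_image_sub_le_of_norm_hasDerivWithin_le
      (fun x _ => (hf' x).hasDerivWithinAt) hM (Set.left_mem_Icc.2 (hs.1.trans hs.2)) hs
    rw [h0', sub_zero, sub_zero, Real.norm_eq_abs, Real.norm_of_nonneg hs.1] at this
    exact this.trans (by gcongr; exact hs.2)
  intro s hs
  have hM0 : 0 ≤ M * t := le_trans (abs_nonneg _) (h1 s hs)
  have := (convex_Icc 0 t).norm_image_sub_le_of_norm_hasDerivWithin_le
    (fun x _ => (hf x).hasDerivWithinAt) h1 (Set.left_mem_Icc.2 (hs.1.trans hs.2)) hs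
  rw [h0, sub_zero, sub_zero, Real.norm_eq_abs, Real.norm_of_nonneg hs.1] at this
  exact this.trans (by gcongr; exact hs.2)

lemma hasDerivAt_two_mul_pow_div_factorial (m : ℕ) (t : ℝ) :
    HasDerivAt (fun t : ℝ => (2 * t) ^ (m + 1) / (m + 1).factorial)
      (2 * ((2 * t) ^ m / m.factorial)) t := by
  have h : HasDerivAt (fun t : ℝ => 2 * t) 2 t := by
    simpa using (hasDerivAt_id t).const_mul 2
  refine HasDerivAt.congr_deriv ((h.fun_pow (m + 1)).div_const ((m + 1).factorial : ℝ)) ?_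
  have := Nat.factorial_pos m
  rw [Nat.factorial_succ]
  push_cast
  field_simp

lemma arcsinTail_le {b N : ℕ} {s t : ℝ} (ht : t < Real.pi / 2) (hs : s ∈ Set.Icc 0 t) :
    |arcsinTail b N s| ≤ (N : ℝ) ^ b * (2 * N + 1) * (Real.sin t ^ 2) ^ N := by
  have hpi := Real.pi_pos
  have h0 : 0 ≤ Real.sin s := Real.sin_nonneg_of_nonneg_of_le_pi hs.1 (by linarith [hs.2])
  have h1 : Real.sin s ≤ Real.sin t :=
    Real.sin_le_sin_of_le_of_le_pi_div_two (by linarith [hs.1]) ht.le hs.2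
  have p := wallisRatio_pos N
  have q := twosLowerSum_nonneg b N
  rw [arcsinTail, abs_of_nonneg (by positivity), pow_mul, div_eq_mul_inv]
  gcongr
  · exact twosLowerSum_le b N
  · exact inv_wallisRatio_le N

lemma tendsto_arcsinTail_bound (b : ℕ) {t : ℝ} (h0 : 0 ≤ t) (ht : t < Real.pi / 2) :
    Filter.Tendsto (fun N : ℕ => (N : ℝ) ^ b * (2 * N + 1) * (Real.sin t ^ 2) ^ N)
      Filter.atTop (nhds 0) := by
  have hs0 : 0 ≤ Real.sin t := Real.sin_nonneg_of_nonneg_of_le_pi h0 (by linarith)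
  have hs1 : Real.sin t < 1 := by
    rw [← Real.sin_pi_div_two]
    exact Real.sin_lt_sin_of_lt_of_le_pi_div_two (by linarith) le_rfl ht
  have hr : |Real.sin t ^ 2| < 1 := by
    rw [abs_of_nonneg (by positivity)]
    exact pow_lt_one₀ hs0 hs1 two_ne_zero
  have h1 := (tendsto_pow_const_mul_const_pow_of_abs_lt_one (b + 1) hr).const_mul 2
  have h2 := tendsto_pow_const_mul_const_pow_of_abs_lt_one b hr
  convert h1.add h2 using 1
  · ext N; ring
  · simp

/-- The inductive step for both the base case, where `G = H = 1`, and the later ones, where `G` is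
the previous partial sum. A uniform error on `[0, t]` for the second derivative is integrated twice
from the zero initial data at 0. -/
lemma arcsin_error_step {b : ℕ} {G : ℕ → ℝ → ℝ} {H : ℝ → ℝ}
    (hsum : ∀ N t, ∑ n ∈ Finset.range N,
      (4 * (twosLowerSum b (n + 1) / wallisRatio n * Real.sin t ^ (2 * n)
        - twosLowerSum b (n + 1) / wallisRatio (n + 1) * Real.sin t ^ (2 * (n + 1)))) =
      4 * (G N t - arcsinTail b N t))
    (hH : ∀ t, H t = (2 * t) ^ (2 * b) / (2 * b).factorial)
    {t : ℝ} (h0 : 0 ≤ t) (ht : t < Real.pi / 2) {e : ℕ → ℝ}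
    (he : Filter.Tendsto e Filter.atTop (nhds 0))
    (heG : ∀ N, ∀ s ∈ Set.Icc 0 t, |G N s - H s| ≤ e N) :
    ∃ e' : ℕ → ℝ, Filter.Tendsto e' Filter.atTop (nhds 0) ∧ ∀ N, ∀ s ∈ Set.Icc 0 t,
      |∑ n ∈ Finset.range N, arcsinTerm b n s - (2 * s) ^ (2 * b + 2) / (2 * b + 2).factorial|
        ≤ e' N := by
  set δ : ℕ → ℝ := fun N => 4 * (e N + (N : ℝ) ^ b * (2 * N + 1) * (Real.sin t ^ 2) ^ N) * t * t
    with hδ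
  have hδ0 : Filter.Tendsto δ Filter.atTop (nhds 0) := by
    have := (((he.add (tendsto_arcsinTail_bound b h0 ht)).const_mul 4).mul_const t).mul_const t
    simpa [hδ] using this
  -- The index shifts by one because the term `n = 0` vanishes and the term `n + 1` has a second
  -- derivative in `sin^(2n)` and `sin^(2n+2)`.
  have key : ∀ N, ∀ s ∈ Set.Icc 0 t, |∑ n ∈ Finset.range (N + 1), arcsinTerm b n s -
      (2 * s) ^ (2 * b + 2) / (2 * b + 2).factorial| ≤ δ N := by
    intro N
    refine abs_le_of_second_deriv_le
      (f' := fun s => ∑ n ∈ Finset.range (N + 1), arcsinTermDeriv b n s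
        - 2 * ((2 * s) ^ (2 * b + 1) / (2 * b + 1).factorial))
      (f'' := fun s => 4 * (G N s - arcsinTail b N s) - 2 * (2 * H s)) ?_ ?_ ?_ ?_ ?_
    · simp only [Finset.sum_range_succ']
      simp [arcsinTerm]
    · simp only [Finset.sum_range_succ']
      simp [arcsinTermDeriv, Nat.mul_add]
    · intro s
      exact (HasDerivAt.fun_sum fun n _ => hasDerivAt_arcsinTerm b n s).sub
        (hasDerivAt_two_mul_pow_div_factorial (2 * b + 1) s)
    · intro s
      rw [← hsum, hH]
      simp only [Finset.sum_range_succ', arcsinTermDeriv_zero_index, add_zero]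
      exact (HasDerivAt.fun_sum fun n _ => hasDerivAt_arcsinTermDeriv_succ b n s).sub
        ((hasDerivAt_two_mul_pow_div_factorial (2 * b) s).const_mul 2)
    · intro s hs
      have h1 := heG N s hs
      have h2 := arcsinTail_le (b := b) (N := N) ht hs
      rw [abs_le] at h1 h2 ⊢
      constructor <;> linarith [h1.1, h1.2, h2.1, h2.2]
  -- For `N = 0` the sum is empty and the error is the monomial itself, largest at `s = t`.
  refine ⟨fun N => if N = 0 then (2 * t) ^ (2 * b + 2) / (2 * b + 2).factorial else δ (N - 1),
    ?_, ?_⟩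
  · rw [← Filter.tendsto_add_atTop_iff_nat 1]
    simpa using hδ0
  · rintro (_ | N) s hs
    · have h2 := hs.1
      simp only [Finset.range_zero, Finset.sum_empty, zero_sub, abs_neg, if_true]
      rw [abs_of_nonneg (by positivity)]
      gcongr
      exact hs.2
    · simpa using key N s hs

lemma arcsin_error (b : ℕ) {t : ℝ} (h0 : 0 ≤ t) (ht : t < Real.pi / 2) :
    ∃ e : ℕ → ℝ, Filter.Tendsto e Filter.atTop (nhds 0) ∧ ∀ N, ∀ s ∈ Set.Icc 0 t,
      |∑ n ∈ Finset.range N, arcsinTerm b n s - (2 * s) ^ (2 * b + 2) / (2 * b + 2).factorial|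
        ≤ e N := by
  induction b with
  | zero =>
    exact arcsin_error_step (G := fun _ _ => 1) (H := fun _ => 1) sum_second_deriv_zero
      (by simp) h0 ht (e := fun _ => 0) tendsto_const_nhds (by simp)
  | succ b ih =>
    obtain ⟨e, he, heG⟩ := ih
    exact arcsin_error_step (sum_second_deriv_succ b) (fun _ => rfl) h0 ht he heG

lemma arcsinTerm_nonneg (b n : ℕ) (t : ℝ) : 0 ≤ arcsinTerm b n t := by
  have p := wallisRatio_pos n
  have q := twosLowerSum_nonneg b n
  have r := Even.pow_nonneg (even_two_mul n) (Real.sin t)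
  unfold arcsinTerm
  positivity

/-- The Taylor expansion of the even powers of the arcsine, evaluated at `sin t`. -/
theorem hasSum_arcsinTerm (b : ℕ) {t : ℝ} (h0 : 0 ≤ t) (ht : t < Real.pi / 2) :
    HasSum (fun n => arcsinTerm b n t) ((2 * t) ^ (2 * b + 2) / (2 * b + 2).factorial) := by
  rw [hasSum_iff_tendsto_nat_of_nonneg fun n => arcsinTerm_nonneg b n t]
  obtain ⟨e, he, heG⟩ := arcsin_error b h0 ht
  rw [tendsto_iff_norm_sub_tendsto_zero]
  exact squeeze_zero (fun _ => norm_nonneg _) (fun N => heG N t ⟨h0, le_rfl⟩) he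

/-! ### The single sum as a cotangent integral. -/

lemma sinMoment_succ_eq_integral_cos (a m : ℕ) :
    sinMoment a (m + 1) = ((m + 1 : ℕ) : ℝ) * ∫ t in (0 : ℝ)..(Real.pi / 2),
      (Real.pi - 2 * t) ^ (2 * a + 1) / (2 * a + 1).factorial *
        (Real.sin t ^ (2 * m + 1) * Real.cos t) := by
  have h := intervalIntegral.integral_eq_sub_of_hasDerivAt
    (fun t _ => ((hasDerivAt_pi_sub_pow_div_factorial (2 * a) t).mul
      (hasDerivAt_sin_pow (2 * m + 1) t)).congr_deriv
      (show _ = 2 * ((m + 1 : ℕ) : ℝ) * ((Real.pi - 2 * t) ^ (2 * a + 1) / (2 * a + 1).factorial *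
        (Real.sin t ^ (2 * m + 1) * Real.cos t)) - 2 * ((Real.pi - 2 * t) ^ (2 * a) /
          (2 * a).factorial * Real.sin t ^ (2 * (m + 1))) by
        rw [show 2 * (m + 1) = 2 * m + 1 + 1 by ring]; push_cast; ring))
    (Continuous.intervalIntegrable (by fun_prop) 0 (Real.pi / 2))
  rw [intervalIntegral.integral_sub (Continuous.intervalIntegrable (by fun_prop) _ _)
    (Continuous.intervalIntegrable (by fun_prop) _ _), intervalIntegral.integral_const_mul,
    intervalIntegral.integral_const_mul] at h
  have h0 : Real.pi - 2 * (Real.pi / 2) = 0 := by ring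
  simp only [Pi.mul_apply, Real.sin_zero, h0] at h
  simp at h
  unfold sinMoment
  push_cast
  linarith

/-- The factor `wallisRatio n` in the denominator of `twosUpperSum` is the one in the arcsine
coefficient, and integration by parts supplies the remaining factor `n`. -/
lemma inv_cube_mul_twosSums (a b n : ℕ) :
    ((n : ℝ) ^ 3)⁻¹ * twosUpperSum a n * twosLowerSum b n = 2 / Real.pi *
      ∫ t in (0 : ℝ)..(Real.pi / 2), (Real.pi - 2 * t) ^ (2 * a + 1) / (2 * a + 1).factorial *
        Real.cot t * arcsinTerm b n t := by
  rcases n with _ | m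
  · simp [arcsinTerm_zero_index]
  have p := wallisRatio_pos (m + 1)
  have hI : ∫ t in (0 : ℝ)..(Real.pi / 2), (Real.pi - 2 * t) ^ (2 * a + 1) / (2 * a + 1).factorial *
        Real.cot t * arcsinTerm b (m + 1) t =
      twosLowerSum b (m + 1) / (((m + 1 : ℕ) : ℝ) ^ 2 * wallisRatio (m + 1)) *
      ∫ t in (0 : ℝ)..(Real.pi / 2), (Real.pi - 2 * t) ^ (2 * a + 1) / (2 * a + 1).factorial *
        (Real.sin t ^ (2 * m + 1) * Real.cos t) := by
    rw [← intervalIntegral.integral_const_mul]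
    refine intervalIntegral.integral_congr fun t _ => ?_
    simp only [arcsinTerm, Real.cot_eq_cos_div_sin]
    rcases eq_or_ne (Real.sin t) 0 with h | h
    · simp [h]
    · rw [show 2 * (m + 1) = 2 * m + 1 + 1 by ring]
      field_simp
      ring
  have hm : ((m + 1 : ℕ) : ℝ) ≠ 0 := by positivity
  rw [hI, twosUpperSum, sinMoment_succ_eq_integral_cos, sinMoment_zero]
  field_simp

lemma sinc_pos {t : ℝ} (ht : t ∈ Set.Icc 0 (Real.pi / 2)) : 0 < Real.sinc t := by
  have hpi := Real.pi_pos
  rcases eq_or_ne t 0 with rfl | h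
  · simp
  · have h0 : 0 < t := lt_of_le_of_ne ht.1 h.symm
    rw [Real.sinc_of_ne_zero h]
    exact div_pos (Real.sin_pos_of_pos_of_lt_pi h0 (by linarith [ht.2])) h0

/-- The quotient of `(π - 2t)^(2a+1) (2t)^(2b+2)` by `sin t`. -/
noncomputable def sinQuotient (a b : ℕ) (t : ℝ) : ℝ :=
  (Real.pi - 2 * t) ^ (2 * a + 1) * (2 * t) ^ (2 * b + 1) * 2 / Real.sinc t

/-- Dividing by `sinc` removes the singularity at 0. This gives integrability here and later the
continuity used with the Riemann–Lebesgue lemma. -/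
lemma continuousOn_sinQuotient (a b : ℕ) :
    ContinuousOn (sinQuotient a b) (Set.Icc 0 (Real.pi / 2)) := by
  refine ContinuousOn.div (by fun_prop) Real.continuous_sinc.continuousOn ?_
  exact fun t ht => (sinc_pos ht).ne'

lemma sinQuotient_mul_sin (a b : ℕ) {t : ℝ} (ht : t ∈ Set.Icc 0 (Real.pi / 2)) :
    sinQuotient a b t * Real.sin t = (Real.pi - 2 * t) ^ (2 * a + 1) * (2 * t) ^ (2 * b + 2) := by
  have h := (sinc_pos ht).ne'
  have hs : Real.sin t = t * Real.sinc t := by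
    rcases eq_or_ne t 0 with rfl | h0
    · simp
    · rw [Real.sinc_of_ne_zero h0]; field_simp
  rw [sinQuotient, hs]
  field_simp
  ring

lemma sinQuotient_mul_cos (a b : ℕ) {t : ℝ} (ht : t ∈ Set.Ioc 0 (Real.pi / 2)) :
    sinQuotient a b t * Real.cos t =
      (Real.pi - 2 * t) ^ (2 * a + 1) * (2 * t) ^ (2 * b + 2) * Real.cot t := by
  have hpi := Real.pi_pos
  have hs : Real.sin t ≠ 0 :=
    (Real.sin_pos_of_pos_of_lt_pi ht.1 (by linarith [ht.2])).ne'
  rw [← sinQuotient_mul_sin a b (Set.Ioc_subset_Icc_self ht), Real.cot_eq_cos_div_sin]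
  field_simp

lemma hasSum_cot_mul_arcsinTerm (a b : ℕ) {t : ℝ} (ht : t ∈ Set.Ioc 0 (Real.pi / 2)) :
    HasSum (fun n => (Real.pi - 2 * t) ^ (2 * a + 1) / (2 * a + 1).factorial *
        Real.cot t * arcsinTerm b n t)
      (((2 * a + 1).factorial * (2 * b + 2).factorial : ℝ)⁻¹ *
        (sinQuotient a b t * Real.cos t)) := by
  -- The arcsine series is available only for `t < π/2`; at `π/2` every term is zero because `cos`
  -- vanishes.
  rcases eq_or_lt_of_le ht.2 with h | h
  · subst h
    simp [Real.cot_eq_cos_div_sin]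
  · rw [sinQuotient_mul_cos a b ht]
    have hs := (hasSum_arcsinTerm b ht.1.le h).mul_left
      ((Real.pi - 2 * t) ^ (2 * a + 1) / (2 * a + 1).factorial * Real.cot t)
    rwa [show (Real.pi - 2 * t) ^ (2 * a + 1) / (2 * a + 1).factorial * Real.cot t *
      ((2 * t) ^ (2 * b + 2) / (2 * b + 2).factorial) =
      ((2 * a + 1).factorial * (2 * b + 2).factorial : ℝ)⁻¹ *
        ((Real.pi - 2 * t) ^ (2 * a + 1) * (2 * t) ^ (2 * b + 2) * Real.cot t) by
      rw [mul_inv]; ring] at hs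

lemma sinQuotient_mul_cos_intervalIntegrable (a b : ℕ) :
    IntervalIntegrable (fun t => sinQuotient a b t * Real.cos t) MeasureTheory.volume 0
      (Real.pi / 2) := by
  refine ContinuousOn.intervalIntegrable ?_
  rw [Set.uIcc_of_le (by positivity)]
  exact (continuousOn_sinQuotient a b).mul (by fun_prop)

/-- All terms are nonnegative, so in dominated convergence they bound themselves: their sum is
continuous, hence integrable. -/
theorem hasSum_inv_cube_mul_twosSums (a b : ℕ) :
    HasSum (fun n : ℕ => ((n : ℝ) ^ 3)⁻¹ * twosUpperSum a n * twosLowerSum b n)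
      (2 / Real.pi * (((2 * a + 1).factorial * (2 * b + 2).factorial : ℝ)⁻¹ *
        ∫ t in (0 : ℝ)..(Real.pi / 2), sinQuotient a b t * Real.cos t)) := by
  simp_rw [inv_cube_mul_twosSums, ← intervalIntegral.integral_const_mul
    ((2 * a + 1).factorial * (2 * b + 2).factorial : ℝ)⁻¹]
  refine HasSum.mul_left _ ?_
  have hI : Set.uIoc 0 (Real.pi / 2) = Set.Ioc 0 (Real.pi / 2) := Set.uIoc_of_le (by positivity)
  refine intervalIntegral.hasSum_integral_of_dominated_convergence
    (fun n t => (Real.pi - 2 * t) ^ (2 * a + 1) / (2 * a + 1).factorial *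
        Real.cot t * arcsinTerm b n t) ?_ ?_ ?_ ?_ ?_
  · intro n
    have : Measurable fun t : ℝ => (Real.pi - 2 * t) ^ (2 * a + 1) / (2 * a + 1).factorial *
        Real.cot t * arcsinTerm b n t := by
      simp only [arcsinTerm, Real.cot_eq_cos_div_sin]
      fun_prop
    exact this.aestronglyMeasurable
  · refine fun n => Filter.Eventually.of_forall fun t ht => ?_
    rw [hI] at ht
    rw [Real.norm_of_nonneg]
    have hc : 0 ≤ Real.cos t := Real.cos_nonneg_of_mem_Icc ⟨by linarith [ht.1, ht.2], ht.2⟩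
    have hs : 0 ≤ Real.sin t :=
      Real.sin_nonneg_of_nonneg_of_le_pi ht.1.le (by linarith [ht.2, Real.pi_pos])
    have h1 : 0 ≤ Real.pi - 2 * t := by linarith [ht.2]
    have := arcsinTerm_nonneg b n t
    rw [Real.cot_eq_cos_div_sin]
    positivity
  · refine Filter.Eventually.of_forall fun t ht => ?_
    rw [hI] at ht
    exact (hasSum_cot_mul_arcsinTerm a b ht).summable
  · refine ((sinQuotient_mul_cos_intervalIntegrable a b).const_mul
      ((2 * a + 1).factorial * (2 * b + 2).factorial : ℝ)⁻¹).congr ?_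
    intro t ht
    rw [hI] at ht
    exact (hasSum_cot_mul_arcsinTerm a b ht).tsum_eq.symm
  · refine Filter.Eventually.of_forall fun t ht => ?_
    rw [hI] at ht
    exact hasSum_cot_mul_arcsinTerm a b ht

/-! ### Integrals of polynomials against sines. -/

open Polynomial in
lemma integral_polynomial_mul_sin_step (P : ℝ[X]) {n : ℕ} (hn : n ≠ 0) :
    ∫ u in (0 : ℝ)..Real.pi, P.eval u * Real.sin (n * u) =
      (P.eval 0 - (-1) ^ n * P.eval Real.pi) / n -
        ((n : ℝ) ^ 2)⁻¹ *
          ∫ u in (0 : ℝ)..Real.pi, (derivative (derivative P)).eval u * Real.sin (n * u) := by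
  have hn' : (n : ℝ) ≠ 0 := by exact_mod_cast hn
  have hl : ∀ u : ℝ, HasDerivAt (fun u : ℝ => (n : ℝ) * u) n u := fun u => by
    simpa using (hasDerivAt_id u).const_mul (n : ℝ)
  have h := intervalIntegral.integral_eq_sub_of_hasDerivAt
    (fun u _ => (((P.derivative.hasDerivAt u).mul (hl u).sin).const_mul ((n : ℝ) ^ 2)⁻¹).sub
      (((P.hasDerivAt u).mul (hl u).cos).const_mul (n : ℝ)⁻¹) |>.congr_deriv
      (show _ = P.eval u * Real.sin (n * u) + ((n : ℝ) ^ 2)⁻¹ *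
        ((derivative (derivative P)).eval u * Real.sin (n * u)) by field_simp; ring))
    (Continuous.intervalIntegrable (by fun_prop) 0 Real.pi)
  rw [intervalIntegral.integral_add (Continuous.intervalIntegrable (by fun_prop) _ _)
    (Continuous.intervalIntegrable (by fun_prop) _ _), intervalIntegral.integral_const_mul] at h
  simp [Real.cos_nat_mul_pi] at h
  field_simp at h ⊢
  linarith

open Polynomial in
lemma integral_polynomial_mul_sin (P : ℝ[X]) {n : ℕ} (hn : n ≠ 0) (K : ℕ)
    (hK : P.natDegree < 2 * K) :
    ∫ u in (0 : ℝ)..Real.pi, P.eval u * Real.sin (n * u) =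
      ∑ j ∈ Finset.range K, (-1) ^ j * ((derivative^[2 * j] P).eval 0 -
        (-1) ^ n * (derivative^[2 * j] P).eval Real.pi) / (n : ℝ) ^ (2 * j + 1) := by
  have hn' : (n : ℝ) ≠ 0 := by exact_mod_cast hn
  have key : ∀ K : ℕ, ∫ u in (0 : ℝ)..Real.pi, P.eval u * Real.sin (n * u) =
      ∑ j ∈ Finset.range K, (-1) ^ j * ((derivative^[2 * j] P).eval 0 -
        (-1) ^ n * (derivative^[2 * j] P).eval Real.pi) / (n : ℝ) ^ (2 * j + 1) +
      (-1) ^ K * ((n : ℝ) ^ (2 * K))⁻¹ *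
        ∫ u in (0 : ℝ)..Real.pi, (derivative^[2 * K] P).eval u * Real.sin (n * u) := by
    intro K
    induction K with
    | zero => simp
    | succ K ih =>
      rw [ih, integral_polynomial_mul_sin_step _ hn, Finset.sum_range_succ,
        show 2 * (K + 1) = 2 * K + 1 + 1 by ring]
      simp only [Function.iterate_succ_apply']
      field_simp
      ring
  -- The remainder involves a derivative of order above the degree.
  rw [key K, iterate_derivative_eq_zero hK]
  simp

/-! ### The weak expansion of the cotangent in sines. -/

lemma two_mul_sin_mul_sum_sin (t : ℝ) (N : ℕ) :
    2 * Real.sin t * ∑ n ∈ Finset.range N, Real.sin ((n + 1 : ℕ) * (2 * t)) =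
      Real.cos t - Real.cos ((2 * N + 1) * t) := by
  induction N with
  | zero => simp
  | succ N ih =>
    rw [Finset.sum_range_succ, mul_add, ih]
    have h1 : (2 * ((N + 1 : ℕ) : ℝ) + 1) * t = ((N + 1 : ℕ) : ℝ) * (2 * t) + t := by ring
    have h2 : (2 * (N : ℝ) + 1) * t = ((N + 1 : ℕ) : ℝ) * (2 * t) - t := by push_cast; ring
    rw [h1, h2, Real.cos_add, Real.cos_sub]
    ring

lemma tendsto_integral_mul_cos_odd {q : ℝ → ℝ} {c : ℝ} (hc : 0 ≤ c)
    (hq : ContinuousOn q (Set.Icc 0 c)) :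
    Filter.Tendsto (fun N : ℕ => ∫ t in (0 : ℝ)..c, q t * Real.cos ((2 * N + 1) * t))
      Filter.atTop (nhds 0) := by
  have hRL := Real.tendsto_integral_exp_smul_cocompact
    (Set.indicator (Set.Ioc 0 c) fun t => (q t : ℂ))
  -- The Fourier character carries a factor `2π`, so this is the frequency whose real part is `cos
  -- ((2N + 1) t)`.
  have hw : Filter.Tendsto (fun N : ℕ => (2 * (N : ℝ) + 1) / (2 * Real.pi)) Filter.atTop
      (Filter.cocompact ℝ) := by
    refine Filter.Tendsto.mono_right ?_ atTop_le_cocompact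
    refine Filter.Tendsto.atTop_div_const (by positivity) ?_
    exact Filter.tendsto_atTop_add_const_right _ _
      (tendsto_natCast_atTop_atTop.const_mul_atTop two_pos)
  have h := (Complex.continuous_re.tendsto 0).comp (hRL.comp hw)
  refine Filter.Tendsto.congr (fun N => ?_) h
  simp only [Function.comp_apply]
  have hind : ∀ v : ℝ, Real.fourierChar (-(v * ((2 * (N : ℝ) + 1) / (2 * Real.pi)))) •
      Set.indicator (Set.Ioc 0 c) (fun t => (q t : ℂ)) v =
      Set.indicator (Set.Ioc 0 c)
        (fun v => (q v : ℂ) * Complex.exp ((-((2 * N + 1) * v) : ℝ) * Complex.I)) v := by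
    intro v
    by_cases hv : v ∈ Set.Ioc 0 c
    · rw [Set.indicator_of_mem hv, Set.indicator_of_mem hv, Circle.smul_def, Real.fourierChar_apply,
        smul_eq_mul, mul_comm]
      congr 3
      push_cast
      field_simp
    · simp [Set.indicator_of_notMem hv]
  simp_rw [hind]
  rw [MeasureTheory.integral_indicator measurableSet_Ioc, ← intervalIntegral.integral_of_le hc]
  have hint : IntervalIntegrable
      (fun v : ℝ => (q v : ℂ) * Complex.exp ((-((2 * N + 1) * v) : ℝ) * Complex.I))
      MeasureTheory.volume 0 c := by
    refine ContinuousOn.intervalIntegrable ?_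
    rw [Set.uIcc_of_le hc]
    exact (Complex.continuous_ofReal.comp_continuousOn hq).mul (by fun_prop)
  have hre := Complex.reCLM.intervalIntegral_comp_comm hint
  rw [Complex.reCLM_apply] at hre
  rw [← hre]
  refine intervalIntegral.integral_congr fun v _ => ?_
  simp only [Complex.reCLM_apply, Complex.re_ofReal_mul, Complex.exp_ofReal_mul_I_re, Real.cos_neg]

/-- The conjugate Dirichlet kernel gives the partial sums as the limit minus `∫ q(t) cos ((2N + 1)
t) dt`, which tends to 0 by Riemann–Lebesgue. -/
lemma tendsto_sum_integral_sin {q : ℝ → ℝ} {c : ℝ} (hc : 0 ≤ c)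
    (hq : ContinuousOn q (Set.Icc 0 c)) :
    Filter.Tendsto (fun N : ℕ => ∑ n ∈ Finset.range N, 2 * ∫ t in (0 : ℝ)..c,
        q t * Real.sin t * Real.sin ((n + 1 : ℕ) * (2 * t)))
      Filter.atTop (nhds (∫ t in (0 : ℝ)..c, q t * Real.cos t)) := by
  have hint : ∀ f : ℝ → ℝ, Continuous f →
      IntervalIntegrable (fun t => q t * f t) MeasureTheory.volume 0 c := by
    intro f hf
    refine ContinuousOn.intervalIntegrable ?_
    rw [Set.uIcc_of_le hc]
    exact hq.mul hf.continuousOn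
  have h := (tendsto_integral_mul_cos_odd hc hq).const_sub (∫ t in (0 : ℝ)..c, q t * Real.cos t)
  rw [sub_zero] at h
  refine h.congr fun N => ?_
  rw [← intervalIntegral.integral_sub (hint _ (by fun_prop)) (hint _ (by fun_prop)),
    ← Finset.mul_sum, ← intervalIntegral.integral_finsetSum]
  · rw [← intervalIntegral.integral_const_mul]
    refine intervalIntegral.integral_congr fun t _ => ?_
    have := two_mul_sin_mul_sum_sin t N
    simp only [← Finset.mul_sum]
    linear_combination -(q t) * this
  · intro n _
    simp_rw [mul_assoc]
    exact hint (fun t => Real.sin t * Real.sin ((n + 1 : ℕ) * (2 * t))) (by fun_prop)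

/-! ### Endpoint derivatives of the polynomial. -/

open Polynomial in
/-- The polynomial `(π - u)^(2a+1) u^(2b+2)`. -/
noncomputable def cotPolynomial (a b : ℕ) : ℝ[X] :=
  (C Real.pi - X) ^ (2 * a + 1) * X ^ (2 * b + 2)

open Polynomial in
lemma natDegree_cotPolynomial_lt (a b : ℕ) :
    (cotPolynomial a b).natDegree < 2 * (a + b + 2) := by
  have h1 : (C Real.pi - X : ℝ[X]).natDegree ≤ 1 := by
    refine (natDegree_sub_le _ _).trans ?_
    simp
  have h2 : ((C Real.pi - X : ℝ[X]) ^ (2 * a + 1)).natDegree ≤ (2 * a + 1) * 1 :=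
    natDegree_pow_le_of_le _ h1
  have h3 : ((X : ℝ[X]) ^ (2 * b + 2)).natDegree ≤ 2 * b + 2 := natDegree_X_pow_le _
  have := natDegree_mul_le_of_le h2 h3
  unfold cotPolynomial
  omega

lemma sum_sinQuotient_integral (a b n : ℕ) :
    2 * ∫ t in (0 : ℝ)..(Real.pi / 2), sinQuotient a b t * Real.sin t *
        Real.sin ((n + 1 : ℕ) * (2 * t)) =
      ∫ u in (0 : ℝ)..Real.pi, (cotPolynomial a b).eval u * Real.sin ((n + 1 : ℕ) * u) := by
  have h := intervalIntegral.integral_comp_mul_left (a := 0) (b := Real.pi / 2)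
    (fun u => (cotPolynomial a b).eval u * Real.sin ((n + 1 : ℕ) * u)) (two_ne_zero (α := ℝ))
  rw [mul_zero, mul_div_cancel₀ _ (two_ne_zero (α := ℝ)), smul_eq_mul] at h
  rw [eq_comm, ← mul_right_inj' (inv_ne_zero (two_ne_zero (α := ℝ))), ← h,
    inv_mul_cancel_left₀ two_ne_zero]
  refine intervalIntegral.integral_congr fun t ht => ?_
  rw [Set.uIcc_of_le (by positivity)] at ht
  rw [sinQuotient_mul_sin a b ht]
  simp [cotPolynomial]

open Polynomial in
lemma coeff_C_sub_X_pow (r : ℝ) (m i : ℕ) :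
    ((C r - X) ^ m : ℝ[X]).coeff i = (-1) ^ i * r ^ (m - i) * m.choose i := by
  rcases lt_or_ge m i with h | h
  · rw [coeff_eq_zero_of_natDegree_lt, Nat.choose_eq_zero_of_lt h]
    · simp
    · refine lt_of_le_of_lt (natDegree_pow_le_of_le m (?_ : _ ≤ 1)) (by simpa using h)
      refine (natDegree_sub_le _ _).trans ?_
      simp
  · obtain ⟨j, rfl⟩ := Nat.exists_eq_add_of_le h
    have : (C r - X : ℝ[X]) ^ (i + j) = C ((-1) ^ (i + j)) * (X + C (-r)) ^ (i + j) := by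
      rw [C_pow, ← mul_pow]
      congr 1
      simp [sub_eq_add_neg, add_comm]
    rw [this, coeff_C_mul, coeff_X_add_C_pow, Nat.add_sub_cancel_left, neg_pow r j, pow_add]
    have h1 : (-1 : ℝ) ^ j * (-1) ^ j = 1 := by rw [← mul_pow]; simp
    linear_combination (-1) ^ i * r ^ j * ((i + j).choose i : ℝ) * h1

/-- `(2j)!` times the coefficient of `X ^ (2j)` in `(π - X)^(2a+1) X^(2b+2)`. -/
noncomputable def cotCoeffZero (a b j : ℕ) : ℝ :=
  if b + 1 ≤ j then (2 * j).factorial * (Real.pi ^ (2 * a + 2 * b + 3 - 2 * j) *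
    (2 * a + 1).choose (2 * j - (2 * b + 2))) else 0

/-- `-(2j)!` times the coefficient of `X ^ (2j)` in `(-X)^(2a+1) (X + π)^(2b+2)`. -/
noncomputable def cotCoeffPi (a b j : ℕ) : ℝ :=
  if a + 1 ≤ j then (2 * j).factorial * (Real.pi ^ (2 * a + 2 * b + 3 - 2 * j) *
    (2 * b + 2).choose (2 * j - (2 * a + 1))) else 0

open Polynomial in
lemma eval_zero_iterate_derivative_cotPolynomial (a b j : ℕ) :
    (derivative^[2 * j] (cotPolynomial a b)).eval 0 = cotCoeffZero a b j := by
  rw [← coeff_zero_eq_eval_zero, coeff_iterate_derivative, cotPolynomial, coeff_mul_X_pow',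
    cotCoeffZero, zero_add, Nat.descFactorial_self]
  by_cases h : b + 1 ≤ j
  · rw [if_pos (by omega), if_pos h, coeff_C_sub_X_pow, nsmul_eq_mul,
      Even.neg_one_pow (by rw [show 2 * j - (2 * b + 2) = 2 * (j - (b + 1)) by omega]; simp),
      one_mul, mul_comm _ ((Nat.choose _ _ : ℕ) : ℝ), mul_comm _ ((Nat.choose _ _ : ℕ) : ℝ)]
    -- Beyond the degree the binomial vanishes, so the truncated exponents of `π` need not agree.
    rcases lt_or_ge (2 * a + 1) (2 * j - (2 * b + 2)) with h' | h'
    · rw [Nat.choose_eq_zero_of_lt h']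
      simp
    · rw [show 2 * a + 1 - (2 * j - (2 * b + 2)) = 2 * a + 2 * b + 3 - 2 * j by omega]
  · rw [if_neg (by omega), if_neg h, smul_zero]

open Polynomial in
-- Read off from the Taylor expansion at `π`, where `π - X` becomes `-X`; its odd exponent produces
-- the minus sign.
lemma eval_pi_iterate_derivative_cotPolynomial (a b j : ℕ) :
    (derivative^[2 * j] (cotPolynomial a b)).eval Real.pi = -cotCoeffPi a b j := by
  have ht : taylor Real.pi (cotPolynomial a b) =
      -((X + C Real.pi) ^ (2 * b + 2) * X ^ (2 * a + 1)) := by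
    rw [cotPolynomial, taylor_mul, taylor_pow, taylor_pow, map_sub, taylor_C, taylor_X,
      show (C Real.pi - (X + C Real.pi) : ℝ[X]) = -X by ring, Odd.neg_pow (odd_two_mul_add_one a)]
    ring
  rw [← factorial_smul_hasseDeriv, LinearMap.smul_apply, eval_smul, ← taylor_coeff, ht, coeff_neg,
    coeff_mul_X_pow', cotCoeffPi]
  by_cases h : a + 1 ≤ j
  · rw [if_pos (by omega), if_pos h, coeff_X_add_C_pow, nsmul_eq_mul, mul_neg,
      mul_comm _ ((Nat.choose _ _ : ℕ) : ℝ), mul_comm _ ((Nat.choose _ _ : ℕ) : ℝ)]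
    rcases lt_or_ge (2 * b + 2) (2 * j - (2 * a + 1)) with h' | h'
    · rw [Nat.choose_eq_zero_of_lt h']
      simp
    · rw [show 2 * b + 2 - (2 * j - (2 * a + 1)) = 2 * a + 2 * b + 3 - 2 * j by omega]
  · rw [if_neg (by omega), if_neg h]
    simp

/-! ### Odd zeta values and evaluation of the integral. -/

/-- The value `ζ(2j + 1)` as a real number. -/
noncomputable def oddZeta (j : ℕ) : ℝ := ∑' n : ℕ, 1 / (n : ℝ) ^ (2 * j + 1)

lemma hasSum_oddZeta {j : ℕ} (hj : j ≠ 0) :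
    HasSum (fun n : ℕ => 1 / ((n + 1 : ℕ) : ℝ) ^ (2 * j + 1)) (oddZeta j) := by
  have h : Summable fun n : ℕ => 1 / (n : ℝ) ^ (2 * j + 1) :=
    Real.summable_one_div_nat_pow.2 (by omega)
  have := (hasSum_nat_add_iff' 1).2 h.hasSum
  simpa [oddZeta] using this

/-- The weight `1 + (-1)^n` keeps twice the even terms, which sum to `2^(-2j) ζ(2j+1)`; subtracting
`ζ(2j+1)` leaves the alternating sum. -/
lemma hasSum_alternating_oddZeta {j : ℕ} (hj : j ≠ 0) :
    HasSum (fun n : ℕ => (-1) ^ (n + 1) / ((n + 1 : ℕ) : ℝ) ^ (2 * j + 1))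
      (-((1 - (2 : ℝ) ^ (-(2 * (j : ℤ)))) * oddZeta j)) := by
  have h : HasSum (fun n : ℕ => 1 / (n : ℝ) ^ (2 * j + 1)) (oddZeta j) :=
    (Real.summable_one_div_nat_pow.2 (by omega)).hasSum
  have heven : HasSum (fun n : ℕ => (1 + (-1) ^ n) / (n : ℝ) ^ (2 * j + 1))
      (2 * ((2 : ℝ) ^ (2 * j + 1))⁻¹ * oddZeta j + 0) := by
    refine HasSum.even_add_odd ?_ ?_
    · refine (h.mul_left (2 * ((2 : ℝ) ^ (2 * j + 1))⁻¹)).congr_fun fun n => ?_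
      rw [Even.neg_one_pow (even_two_mul n), Nat.cast_mul, mul_pow, div_eq_mul_inv _ (_ * _),
        mul_inv, Nat.cast_ofNat]
      ring
    · refine hasSum_zero.congr_fun fun n => ?_
      rw [Odd.neg_one_pow (odd_two_mul_add_one n)]
      simp
  have h1 := (hasSum_nat_add_iff' 1).2 (heven.sub h)
  have hz : (2 : ℝ) ^ (-(2 * (j : ℤ))) = 2 * ((2 : ℝ) ^ (2 * j + 1))⁻¹ := by
    rw [zpow_neg, pow_succ]
    field_simp
    norm_cast
  rw [Finset.sum_range_one] at h1
  have hv : 2 * ((2 : ℝ) ^ (2 * j + 1))⁻¹ * oddZeta j + 0 - oddZeta j -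
      ((1 + (-1) ^ 0) / ((0 : ℕ) : ℝ) ^ (2 * j + 1) - 1 / ((0 : ℕ) : ℝ) ^ (2 * j + 1)) =
      -((1 - (2 : ℝ) ^ (-(2 * (j : ℤ)))) * oddZeta j) := by
    rw [hz]
    simp
    ring
  rw [hv] at h1
  exact h1.congr_fun fun n => by ring

lemma ofReal_oddZeta {j : ℕ} (hj : j ≠ 0) :
    ((oddZeta j : ℝ) : ℂ) = riemannZeta (2 * (j : ℂ) + 1) := by
  have h := zeta_nat_eq_tsum_of_gt_one (k := 2 * j + 1) (by omega)
  push_cast at h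
  rw [h, oddZeta]
  push_cast
  rfl

theorem integral_sinQuotient_mul_cos (a b : ℕ) :
    ∫ t in (0 : ℝ)..(Real.pi / 2), sinQuotient a b t * Real.cos t =
      ∑ j ∈ Finset.range (a + b + 2), ((-1) ^ j * cotCoeffZero a b j * oddZeta j -
        (-1) ^ j * cotCoeffPi a b j * ((1 - (2 : ℝ) ^ (-(2 * (j : ℤ)))) * oddZeta j)) := by
  refine tendsto_nhds_unique
    (tendsto_sum_integral_sin (by positivity) (continuousOn_sinQuotient a b)) ?_
  simp_rw [sum_sinQuotient_integral]
  refine HasSum.tendsto_sum_nat ?_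
  simp_rw [fun n : ℕ => integral_polynomial_mul_sin _ (Nat.succ_ne_zero n) _
    (natDegree_cotPolynomial_lt a b), eval_zero_iterate_derivative_cotPolynomial,
    eval_pi_iterate_derivative_cotPolynomial]
  refine hasSum_sum fun j _ => ?_
  -- Both coefficients vanish at `j = 0`, so the divergent harmonic series never enters.
  rcases Nat.eq_zero_or_pos j with rfl | hj
  · simp [cotCoeffZero, cotCoeffPi]
  · have h := ((hasSum_oddZeta hj.ne').mul_left ((-1) ^ j * cotCoeffZero a b j)).add
      ((hasSum_alternating_oddZeta hj.ne').mul_left ((-1) ^ j * cotCoeffPi a b j))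
    rw [mul_neg, ← sub_eq_add_neg] at h
    refine h.congr_fun fun n => ?_
    rw [Nat.succ_eq_add_one]
    ring

/-! ### Reduction of the multiple sum to a single sum, in `ℝ≥0∞` so that rearrangement is free. -/

/-- Prepending an entry to an index of a multiple zeta value. -/
def MZVIndex.cons {r : ℕ} (n : ℕ) (t : MZVIndex r) (h0 : 0 < n) (h : ∀ i, t.1 i < n) :
    MZVIndex (r + 1) :=
  ⟨Fin.cons n t.1, by
    constructor
    · intro i j hij
      induction j using Fin.cases with
      | zero => exact absurd hij (Fin.not_lt_zero i)
      | succ j =>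
        induction i using Fin.cases with
        | zero => simpa using h j
        | succ i => simpa using t.2.1 (Fin.succ_lt_succ_iff.1 hij)
    · intro i
      induction i using Fin.cases with
      | zero => simpa using h0
      | succ i => simpa using t.2.2 i⟩

/-- An index of depth `r + 1` is its first entry together with the remaining entries. -/
def MZVIndex.consEquiv (r : ℕ) :
    (Σ n : ℕ, {t : MZVIndex r // 0 < n ∧ ∀ i, t.1 i < n}) ≃ MZVIndex (r + 1) where
  toFun x := MZVIndex.cons x.1 x.2.1 x.2.2.1 x.2.2.2
  invFun n := ⟨n.1 0, ⟨⟨fun i => n.1 i.succ,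
    fun _ _ hij => n.2.1 (Fin.succ_lt_succ_iff.2 hij), fun i => n.2.2 i.succ⟩,
    n.2.2 0, fun i => n.2.1 (Fin.succ_pos i)⟩⟩
  left_inv _ := rfl
  right_inv n := Subtype.ext (Fin.cons_self_tail n.1)

open scoped ENNReal

/-- The multiple harmonic sum `∑_{N > n₁ > ⋯ > n_r > 0} n₁ ^ (-a₁) ⋯ n_r ^ (-a_r)`. -/
noncomputable def multiHarmonic : List ℕ → ℕ → ℝ≥0∞
  | [], _ => 1
  | s :: l, N => ∑ n ∈ Finset.range N, ENNReal.ofReal ((n : ℝ) ^ s)⁻¹ * multiHarmonic l n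

lemma mzvTerm_cons (s : ℕ) (l : List ℕ) (n : ℕ) (t : MZVIndex l.length) (h0 : 0 < n)
    (h : ∀ i, t.1 i < n) :
    mzvTerm (s :: l) (MZVIndex.cons n t h0 h) = ((n : ℝ) ^ s)⁻¹ * mzvTerm l t := by
  unfold mzvTerm
  exact Fin.prod_univ_succ _

lemma mzvTerm_nonneg (l : List ℕ) (n : MZVIndex l.length) : 0 ≤ mzvTerm l n :=
  Finset.prod_nonneg fun _ _ => by positivity

/-- Fibring over the largest variable. The predicate `p` lets one argument serve both the truncated
and the full sums. -/
lemma tsum_mzvTerm_cons (s : ℕ) (hs : s ≠ 0) (l : List ℕ)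
    (hl : ∀ N : ℕ, ∑' t : {t : MZVIndex l.length // ∀ i, t.1 i < N},
      ENNReal.ofReal (mzvTerm l t.1) = multiHarmonic l N) (p : ℕ → Prop) [DecidablePred p] :
    ∑' t : {t : MZVIndex (s :: l).length // p (t.1 0)}, ENNReal.ofReal (mzvTerm (s :: l) t.1) =
      ∑' n : ℕ, if p n then ENNReal.ofReal ((n : ℝ) ^ s)⁻¹ * multiHarmonic l n else 0 := by
  refine (tsum_subtype {t : MZVIndex (s :: l).length | p (t.1 (0 : Fin (l.length + 1)))}
    (fun t => ENNReal.ofReal (mzvTerm (s :: l) t))).trans ?_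
  refine ((MZVIndex.consEquiv l.length).tsum_eq _).symm.trans ?_
  rw [ENNReal.tsum_sigma']
  refine tsum_congr fun n => ?_
  have hcons : ∀ x : {t : MZVIndex l.length // 0 < n ∧ ∀ i, t.1 i < n},
      Set.indicator {t : MZVIndex (s :: l).length | p (t.1 0)}
        (fun t => ENNReal.ofReal (mzvTerm (s :: l) t)) (MZVIndex.consEquiv l.length ⟨n, x⟩) =
      if p n then ENNReal.ofReal ((n : ℝ) ^ s)⁻¹ * ENNReal.ofReal (mzvTerm l x.1) else 0 := by
    intro x
    rw [← ENNReal.ofReal_mul (by positivity), ← mzvTerm_cons s l n x.1 x.2.1 x.2.2]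
    by_cases hp : p n
    · rw [if_pos hp]
      exact Set.indicator_of_mem (s := {t : MZVIndex (s :: l).length |
        p (t.1 (0 : Fin (l.length + 1)))}) hp _
    · rw [if_neg hp]
      exact Set.indicator_of_notMem (s := {t : MZVIndex (s :: l).length |
        p (t.1 (0 : Fin (l.length + 1)))}) hp _
  rw [tsum_congr hcons]
  split_ifs with hp
  · rw [ENNReal.tsum_mul_left]
    -- There are no indices with `n = 0`; the right side agrees because `s ≠ 0` makes `(0 ^ s)⁻¹ =
    -- 0`.
    rcases Nat.eq_zero_or_pos n with rfl | hn
    · simp [hs]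
    · rw [← hl n]
      congr 1
      exact (Equiv.subtypeEquivRight fun t => by simp [hn]).tsum_eq
        (fun t : {t : MZVIndex l.length // ∀ i, t.1 i < n} => ENNReal.ofReal (mzvTerm l t.1))
  · simp

lemma tsum_mzvTerm_lt (l : List ℕ) (hl : ∀ s ∈ l, s ≠ 0) (N : ℕ) :
    ∑' t : {t : MZVIndex l.length // ∀ i, t.1 i < N}, ENNReal.ofReal (mzvTerm l t.1) =
      multiHarmonic l N := by
  induction l generalizing N with
  | nil =>
    have : Unique {t : MZVIndex ([] : List ℕ).length // ∀ i, t.1 i < N} :=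
      { default := ⟨⟨fun i => i.elim0, fun i => i.elim0, fun i => i.elim0⟩, fun i => i.elim0⟩
        uniq := fun t => Subtype.ext (Subtype.ext (funext fun i => i.elim0)) }
    rw [tsum_fintype, Fintype.sum_unique]
    simp [multiHarmonic, mzvTerm]
  | cons s l ih =>
    have h := tsum_mzvTerm_cons s (hl s (by simp)) l (ih fun x hx => hl x (by simp [hx]))
      (fun n => n < N)
    have e : ∀ t : MZVIndex (s :: l).length, (∀ i, t.1 i < N) ↔ t.1 (0 : Fin (l.length + 1)) < N :=
      fun t => ⟨fun h => h _, fun h i => (t.2.1.antitone (Fin.zero_le i)).trans_lt h⟩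
    rw [← (Equiv.subtypeEquivRight e).symm.tsum_eq]
    refine h.trans ?_
    rw [multiHarmonic, tsum_eq_sum (s := Finset.range N) fun n hn => if_neg (by simpa using hn)]
    exact Finset.sum_congr rfl fun n hn => if_pos (Finset.mem_range.1 hn)

lemma tsum_mzvTerm (s : ℕ) (l : List ℕ) (hl : ∀ x ∈ s :: l, x ≠ 0) :
    ∑' t : MZVIndex (s :: l).length, ENNReal.ofReal (mzvTerm (s :: l) t) =
      ∑' n : ℕ, ENNReal.ofReal ((n : ℝ) ^ s)⁻¹ * multiHarmonic l n := by
  have h := tsum_mzvTerm_cons s (hl s (by simp)) l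
    (tsum_mzvTerm_lt l fun x hx => hl x (by simp [hx])) (fun _ => True)
  simp only [if_true] at h
  rw [← h]
  exact ((Equiv.Set.univ _).tsum_eq _).symm

lemma multiHarmonic_replicate_two (b n : ℕ) :
    multiHarmonic (List.replicate b 2) n = ENNReal.ofReal (twosLowerSum b n) := by
  induction b generalizing n with
  | zero => simp [multiHarmonic, twosLowerSum]
  | succ b ih =>
    rw [List.replicate_succ, multiHarmonic, twosLowerSum, ENNReal.ofReal_sum_of_nonneg
      fun m _ => mul_nonneg (by positivity) (twosLowerSum_nonneg b m)]
    refine Finset.sum_congr rfl fun m _ => ?_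
    rw [ih, ENNReal.ofReal_mul (by positivity)]

lemma tsum_if_lt_twosUpperSum (a n : ℕ) :
    ∑' m : ℕ, (if n < m then ENNReal.ofReal ((m : ℝ) ^ 2)⁻¹ * ENNReal.ofReal (twosUpperSum a m)
      else 0) = ENNReal.ofReal (twosUpperSum (a + 1) n) := by
  have hs := hasSum_twosUpperSum a n
  have hsplit := Summable.sum_add_tsum_nat_add' (k := n + 1) (f := fun m : ℕ =>
    if n < m then ENNReal.ofReal ((m : ℝ) ^ 2)⁻¹ * ENNReal.ofReal (twosUpperSum a m) else 0)
    ENNReal.summable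
  rw [← hs.tsum_eq, ENNReal.ofReal_tsum_of_nonneg
    (fun m => mul_nonneg (by positivity) (twosUpperSum_nonneg _ _)) hs.summable,
    ← hsplit]
  rw [Finset.sum_eq_zero fun m hm => if_neg (by have := Finset.mem_range.1 hm; omega), zero_add]
  refine tsum_congr fun m => ?_
  rw [if_pos (by omega), ENNReal.ofReal_mul (by positivity), show n + m + 1 = m + (n + 1) by ring]

lemma tsum_twosUpperSum_mul_sum (a : ℕ) (φ : ℕ → ℝ≥0∞) :
    ∑' n : ℕ, ENNReal.ofReal ((n : ℝ) ^ 2)⁻¹ * ENNReal.ofReal (twosUpperSum a n) *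
        ∑ m ∈ Finset.range n, φ m =
      ∑' m : ℕ, ENNReal.ofReal (twosUpperSum (a + 1) m) * φ m := by
  simp_rw [← tsum_if_lt_twosUpperSum, ← ENNReal.tsum_mul_right]
  rw [ENNReal.tsum_comm]
  refine tsum_congr fun n => ?_
  rw [tsum_eq_sum (s := Finset.range n) fun m hm => by simp_all, Finset.mul_sum]
  exact Finset.sum_congr rfl fun m hm => by rw [if_pos (Finset.mem_range.1 hm)]

/-- Exchanging summations absorbs the leading twos into the upper sum one at a time; `c` counts
those already absorbed, so it must vary in the induction. -/
lemma tsum_twosUpperSum_mul_multiHarmonic (a c s : ℕ) (l : List ℕ) :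
    ∑' n : ℕ, ENNReal.ofReal ((n : ℝ) ^ 2)⁻¹ * ENNReal.ofReal (twosUpperSum c n) *
        multiHarmonic (List.replicate a 2 ++ s :: l) n =
      ∑' n : ℕ, ENNReal.ofReal (twosUpperSum (c + a + 1) n) *
        (ENNReal.ofReal ((n : ℝ) ^ s)⁻¹ * multiHarmonic l n) := by
  induction a generalizing c with
  | zero => exact tsum_twosUpperSum_mul_sum c _
  | succ a ih =>
    have h := tsum_twosUpperSum_mul_sum c fun n =>
      ENNReal.ofReal ((n : ℝ) ^ 2)⁻¹ * multiHarmonic (List.replicate a 2 ++ s :: l) n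
    refine Eq.trans h ?_
    rw [show c + (a + 1) + 1 = (c + 1) + a + 1 by ring, ← ih (c + 1)]
    exact tsum_congr fun n => by ring

lemma tsum_mzvTerm_twosThreeTwos (a b : ℕ) :
    ∑' t : MZVIndex (twosThreeTwos a b).length, ENNReal.ofReal (mzvTerm (twosThreeTwos a b) t) =
      ∑' n : ℕ, ENNReal.ofReal (((n : ℝ) ^ 3)⁻¹ * twosUpperSum a n * twosLowerSum b n) := by
  have hr : ∀ n : ℕ, ENNReal.ofReal (((n : ℝ) ^ 3)⁻¹ * twosUpperSum a n * twosLowerSum b n) =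
      ENNReal.ofReal (twosUpperSum a n) *
        (ENNReal.ofReal ((n : ℝ) ^ 3)⁻¹ * multiHarmonic (List.replicate b 2) n) := by
    intro n
    rw [multiHarmonic_replicate_two, ENNReal.ofReal_mul (mul_nonneg (by positivity)
      (twosUpperSum_nonneg _ _)), ENNReal.ofReal_mul (by positivity)]
    ring
  simp_rw [hr]
  rcases a with _ | a
  · simp only [twosUpperSum_zero, ENNReal.ofReal_one, one_mul]
    exact tsum_mzvTerm 3 (List.replicate b 2) (by simp)
  · have h := tsum_twosUpperSum_mul_multiHarmonic a 0 3 (List.replicate b 2)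
    rw [zero_add] at h
    rw [← h]
    simp only [twosUpperSum_zero, ENNReal.ofReal_one, mul_one]
    exact tsum_mzvTerm 2 (List.replicate a 2 ++ 3 :: List.replicate b 2)
      (by simp; rintro x (⟨_, rfl⟩ | rfl | ⟨_, rfl⟩) <;> norm_num)

/-- The identity in `ℝ≥0∞` has a finite right side, which yields convergence as well as the value.
-/
lemma summable_mzvTerm_and_multiZeta {a b : ℕ} {v : ℝ}
    (h : HasSum (fun n : ℕ => ((n : ℝ) ^ 3)⁻¹ * twosUpperSum a n * twosLowerSum b n) v) :
    Summable (mzvTerm (twosThreeTwos a b)) ∧ multiZeta (twosThreeTwos a b) = v := by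
  have hnn : ∀ n : ℕ, 0 ≤ ((n : ℝ) ^ 3)⁻¹ * twosUpperSum a n * twosLowerSum b n := fun n =>
    mul_nonneg (mul_nonneg (by positivity) (twosUpperSum_nonneg _ _)) (twosLowerSum_nonneg _ _)
  have ht := tsum_mzvTerm_twosThreeTwos a b
  rw [← ENNReal.ofReal_tsum_of_nonneg hnn h.summable, h.tsum_eq] at ht
  have hm := mzvTerm_nonneg (twosThreeTwos a b)
  have hS : Summable (mzvTerm (twosThreeTwos a b)) := by
    have := ENNReal.summable_toReal (ht.trans_ne ENNReal.ofReal_ne_top)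
    simpa only [ENNReal.toReal_ofReal (hm _)] using this
  refine ⟨hS, ?_⟩
  rw [← ENNReal.ofReal_tsum_of_nonneg hm hS] at ht
  exact (ENNReal.ofReal_eq_ofReal_iff (tsum_nonneg hm) (h.nonneg hnn)).1 ht

/-! ### Matching factorials and binomials, and the final formula. -/

lemma cotCoeffZero_div {a b j : ℕ} (h1 : b + 1 ≤ j) (h2 : j ≤ a + b + 1) :
    1 / Real.pi * (((2 * a + 1).factorial * (2 * b + 2).factorial : ℝ)⁻¹ * cotCoeffZero a b j) =
      (2 * j).choose (2 * b + 2) * (Real.pi ^ (2 * a + 2 * b + 2 - 2 * j) /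
        (2 * a + 2 * b + 3 - 2 * j).factorial) := by
  -- Writing `j = b + 1 + i` and `a = i + c` makes every truncated subtraction exact.
  obtain ⟨i, rfl⟩ := Nat.exists_eq_add_of_le h1
  obtain ⟨c, rfl⟩ := Nat.exists_eq_add_of_le (show i ≤ a by omega)
  rw [cotCoeffZero, if_pos h1, show 2 * (b + 1 + i) = 2 * i + (2 * b + 2) by ring,
    show 2 * i + (2 * b + 2) - (2 * b + 2) = 2 * i by omega,
    show 2 * (i + c) + 2 * b + 3 - (2 * i + (2 * b + 2)) = 2 * c + 1 by omega,
    show 2 * (i + c) + 2 * b + 2 - (2 * i + (2 * b + 2)) = 2 * c by omega,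
    show 2 * (i + c) + 1 = 2 * i + (2 * c + 1) by ring,
    Nat.cast_add_choose, Nat.add_comm (2 * i) (2 * b + 2), Nat.cast_add_choose]
  have f1 := Nat.factorial_ne_zero (2 * i + (2 * c + 1))
  have := Real.pi_ne_zero
  field_simp
  ring

lemma cotCoeffPi_div {a b j : ℕ} (h1 : a + 1 ≤ j) (h2 : j ≤ a + b + 1) :
    1 / Real.pi * (((2 * a + 1).factorial * (2 * b + 2).factorial : ℝ)⁻¹ * cotCoeffPi a b j) =
      (2 * j).choose (2 * a + 1) * (Real.pi ^ (2 * a + 2 * b + 2 - 2 * j) /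
        (2 * a + 2 * b + 3 - 2 * j).factorial) := by
  obtain ⟨i, rfl⟩ := Nat.exists_eq_add_of_le h1
  obtain ⟨c, rfl⟩ := Nat.exists_eq_add_of_le (show i ≤ b by omega)
  rw [cotCoeffPi, if_pos h1, show 2 * (a + 1 + i) = (2 * a + 1) + (2 * i + 1) by ring,
    show 2 * a + 1 + (2 * i + 1) - (2 * a + 1) = 2 * i + 1 by omega,
    show 2 * a + 2 * (i + c) + 3 - (2 * a + 1 + (2 * i + 1)) = 2 * c + 1 by omega,
    show 2 * a + 2 * (i + c) + 2 - (2 * a + 1 + (2 * i + 1)) = 2 * c by omega,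
    show 2 * (i + c) + 2 = 2 * i + 1 + (2 * c + 1) by ring,
    Nat.cast_add_choose, Nat.cast_add_choose]
  have f1 := Nat.factorial_ne_zero (2 * i + 1 + (2 * c + 1))
  have := Real.pi_ne_zero
  field_simp
  ring

lemma sum_range_eq_sum_Icc {m N : ℕ} {f : ℕ → ℝ} (hf : ∀ j, j < m → f j = 0) :
    ∑ j ∈ Finset.range (N + 1), f j = ∑ j ∈ Finset.Icc m N, f j := by
  refine (Finset.sum_subset (fun j hj => ?_) fun j hj hj' => hf j ?_).symm
  · simp only [Finset.mem_Icc, Finset.mem_range] at hj ⊢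
    omega
  · simp only [Finset.mem_Icc, Finset.mem_range] at hj hj'
    omega

lemma twosThreeTwos_value (a b : ℕ) :
    2 / Real.pi * (((2 * a + 1).factorial * (2 * b + 2).factorial : ℝ)⁻¹ *
        ∫ t in (0 : ℝ)..(Real.pi / 2), sinQuotient a b t * Real.cos t) =
      2 * ∑ r ∈ Finset.Icc (b + 1) (a + b + 1), (-1) ^ r * ((2 * r).choose (2 * b + 2) : ℝ) *
          (Real.pi ^ (2 * a + 2 * b + 2 - 2 * r) / (2 * a + 2 * b + 3 - 2 * r).factorial) *
          oddZeta r
      - 2 * ∑ r ∈ Finset.Icc (a + 1) (a + b + 1), (-1) ^ r * ((2 * r).choose (2 * a + 1) : ℝ) *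
          (Real.pi ^ (2 * a + 2 * b + 2 - 2 * r) / (2 * a + 2 * b + 3 - 2 * r).factorial) *
          (1 - (2 : ℝ) ^ (-(2 * (r : ℤ)))) * oddZeta r := by
  rw [integral_sinQuotient_mul_cos, Finset.sum_sub_distrib,
    sum_range_eq_sum_Icc (m := b + 1) (N := a + b + 1) (fun j hj => by
      rw [cotCoeffZero, if_neg (by omega)]; simp),
    sum_range_eq_sum_Icc (m := a + 1) (N := a + b + 1) (fun j hj => by
      rw [cotCoeffPi, if_neg (by omega)]; simp)]
  simp only [mul_sub, Finset.mul_sum]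
  congr 1
  · refine Finset.sum_congr rfl fun j hj => ?_
    have h := cotCoeffZero_div (Finset.mem_Icc.1 hj).1 (Finset.mem_Icc.1 hj).2
    linear_combination 2 * (-1) ^ j * oddZeta j * h
  · refine Finset.sum_congr rfl fun j hj => ?_
    have h := cotCoeffPi_div (Finset.mem_Icc.1 hj).1 (Finset.mem_Icc.1 hj).2
    linear_combination 2 * (-1) ^ j * (1 - (2 : ℝ) ^ (-(2 * (j : ℤ)))) * oddZeta j * h

theorem mainTheorem9 (a b k : ℕ) (hk : k = 2 * a + 2 * b + 3) :
    Summable (mzvTerm (twosThreeTwos a b)) ∧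
    ((multiZeta (twosThreeTwos a b) : ℝ) : ℂ) =
      2 * ∑ r ∈ Finset.Icc (b + 1) (a + b + 1),
          (-1 : ℂ) ^ r * (Nat.choose (2 * r) (2 * b + 2) : ℂ) *
            ((Real.pi : ℂ) ^ (k - 1 - 2 * r) / (Nat.factorial (k - 2 * r) : ℂ)) *
            riemannZeta (2 * (r : ℂ) + 1)
      - 2 * ∑ r ∈ Finset.Icc (a + 1) (a + b + 1),
          (-1 : ℂ) ^ r * (Nat.choose (2 * r) (2 * a + 1) : ℂ) *
            ((Real.pi : ℂ) ^ (k - 1 - 2 * r) / (Nat.factorial (k - 2 * r) : ℂ)) *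
            (1 - (2 : ℂ) ^ (-(2 * (r : ℤ)))) * riemannZeta (2 * (r : ℂ) + 1) := by
  subst hk
  obtain ⟨hS, hv⟩ := summable_mzvTerm_and_multiZeta (hasSum_inv_cube_mul_twosSums a b)
  refine ⟨hS, ?_⟩
  rw [hv, twosThreeTwos_value, Complex.ofReal_sub, Complex.ofReal_mul, Complex.ofReal_mul,
    Complex.ofReal_sum, Complex.ofReal_sum, Complex.ofReal_ofNat]
  congr 2
  · refine Finset.sum_congr rfl fun r hr => ?_
    rw [← ofReal_oddZeta (by have := (Finset.mem_Icc.1 hr).1; omega)]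
    push_cast
    rfl
  · refine Finset.sum_congr rfl fun r hr => ?_
    rw [← ofReal_oddZeta (by have := (Finset.mem_Icc.1 hr).1; omega)]
    push_cast
    rfl
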